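/- Let $M$ be a smooth ($C^\infty$), connected, paracompact, Hausdorff finite-dimensional manifold with tangent bundle $\pi: TM\to M$. For $v\in TM$ let $\mathcal V_v=\ker(\pi_*:T_vTM\to T_{\pi(v)}M)$ be the vertical space, and let $K:\mathcal V_v\to T_{\pi(v)}M$ be the canonical isomorphism, i.e. the inverse of the vertical lift $w\mapsto \frac{d}{dt}\big|_{t=0}(v+tw)$. Let $\mathcal H$ be a (possibly nonlinear) connection on $M$, that is, a smooth vector subbundle $\mathcal H$ of $TTM\to TM$ with $T_vTM=\mathcal H_v\oplus\mathcal V_v$ for every $v\in TM$, and let $H_v:T_vTM\to T_vTM$ be the projection with image $\mathcal H_v$ and kernel $\mathcal V_v$. The geodesic quasispray of $\mathcal H$ is the vector field $S$ on $TM$ given by $S(v)=(\pi_*|_{\mathcal H_v})^{-1}(v)$. A curve $c$ in $M$ is a geodesic of $\mathcal H$ if its canonical lift $\dot c$ to $TM$ is an integral curve of $S$, i.e. $\ddot c=S(\dot c)$. The covariant derivative associated to $\mathcal H$ is $\nabla_UV=\kappa(V_*U)$ with $\kappa(z)=K(z-H_vz)$ for $z\in T_vTM$; it is also applied to vector fields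 along a curve, so that $\nabla_{\dot c}\dot c=\kappa(\ddot c)$, where $\ddot c$ is the velocity of the curve $\dot c$ in $TM$. Theorem. Let $c$ be a $C^2$ curve in $M$ defined on an open interval. Then $c$ is a geodesic of $\mathcal H$ if and only if $\nabla_{\dot c}\,\dot c=0$ along $c$. -/

import Mathlib

open Bundle Set
open scoped Manifold ContDiff

noncomputable section

namespace NonlinearConnection

variable {E : Type*} [NormedAddCommGroup E] [NormedSpace ℝ E]
  {M : Type*} [TopologicalSpace M] [ChartedSpace E M] [IsManifold 𝓘(ℝ, E) ∞ M]

variable (E M) in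
/-- The tangent bundle `TM`. -/
abbrev TM : Type _ := TangentBundle 𝓘(ℝ, E) M

/-- The fibre `T_v TM` of `TTM → TM` over `v ∈ TM`. -/
abbrev TTM (v : TM E M) : Type _ := TangentSpace 𝓘(ℝ, E).tangent v

/-- `π_*` at `v`: the differential `T_v TM → T_p M` of the projection `π : TM → M`, `p = π v`. -/
def projStar (v : TM E M) : TTM v →ₗ[ℝ] TangentSpace 𝓘(ℝ, E) v.proj :=
  (mfderiv 𝓘(ℝ, E).tangent 𝓘(ℝ, E) (fun w : TM E M => w.proj) v).toLinearMap

/-- The vertical space `ker π_*` in `T_v TM`. -/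
def vertical (v : TM E M) : Submodule ℝ (TTM v) := LinearMap.ker (projStar v)

/-- The inclusion of the vector space `T_p M`, whose underlying type is `E`, as a fibre of `TM`. -/
def fibreIncl (p : M) (w : E) : TM E M := ⟨p, w⟩

/-- The vector `v` as an element of the vector space `T_p M`, `p = π v`, with underlying type `E`. -/
def vec (v : TM E M) : E := v.snd

/-- The canonical vertical lift `T_p M → T_v TM`, `p = π v`: the differential at `v` of the inclusion
of the vector space `T_p M` as a fibre of `TM`. -/
def vertLift (v : TM E M) : TangentSpace 𝓘(ℝ, E) v.proj →ₗ[ℝ] TTM v :=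
  (mfderiv 𝓘(ℝ, E) 𝓘(ℝ, E).tangent (fibreIncl v.proj) (vec v)).toLinearMap

variable (E) in
/-- The canonical trivialization restricted to the fibre over `p`. -/
def fibreEquiv (p : M) : E ≃L[ℝ] E :=
  (trivializationAt E (TangentSpace 𝓘(ℝ, E)) p).continuousLinearEquivAt ℝ p
    (FiberBundle.mem_baseSet_trivializationAt' p)

theorem contMDiff_fibreIncl (p : M) :
    ContMDiff 𝓘(ℝ, E) 𝓘(ℝ, E).tangent ∞ (fibreIncl p : E → TM E M) := by
  intro w
  rw [contMDiffAt_totalSpace]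
  exact ⟨contMDiffAt_const, (fibreEquiv E p : E →L[ℝ] E).contMDiff.contMDiffAt⟩

theorem mdifferentiableAt_proj (v : TM E M) :
    MDifferentiableAt 𝓘(ℝ, E).tangent 𝓘(ℝ, E) (fun w : TM E M => w.proj) v :=
  (contMDiff_proj (n := ∞) (IB := 𝓘(ℝ, E)) (F := E) (TangentSpace 𝓘(ℝ, E) : M → Type _)
    |>.contMDiffAt).mdifferentiableAt (by simp)

theorem projStar_surjective (v : TM E M) : Function.Surjective (projStar v) := by
  intro u
  let σ : M → TM E M := fun x => ⟨x, FiberBundle.extend E v.snd x⟩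
  have hσ : MDifferentiableAt 𝓘(ℝ, E) 𝓘(ℝ, E).tangent σ v.proj :=
    (FiberBundle.contMDiffAt_extend (k := ∞) 𝓘(ℝ, E) E v.snd).mdifferentiableAt (by simp)
  have hv : σ v.proj = v := by
    simp [σ]
  have hπ : MDifferentiableAt 𝓘(ℝ, E).tangent 𝓘(ℝ, E) (fun w : TM E M => w.proj) (σ v.proj) :=
    mdifferentiableAt_proj _
  have hc := mfderiv_comp v.proj hπ hσ
  have hid : (fun w : TM E M => w.proj) ∘ σ = id := rfl
  rw [hid, mfderiv_id] at hc
  have key : Function.Surjective (projStar (σ v.proj)) := fun u =>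
    ⟨mfderiv 𝓘(ℝ, E) 𝓘(ℝ, E).tangent σ v.proj u, (DFunLike.congr_fun hc u).symm⟩
  rw [hv] at key
  exact key u

theorem vertLift_injective (v : TM E M) : Function.Injective (vertLift v) := by
  let ψ : TM E M → E := fun w => (trivializationAt E (TangentSpace 𝓘(ℝ, E)) v.proj w).2
  let L := fibreEquiv E v.proj
  have hψ : MDifferentiableAt 𝓘(ℝ, E).tangent 𝓘(ℝ, E) ψ v :=
    (contMDiffAt_totalSpace.1 (contMDiffAt_id (n := ∞))).2.mdifferentiableAt (by simp)
  have hι : MDifferentiableAt 𝓘(ℝ, E) 𝓘(ℝ, E).tangent (fibreIncl v.proj)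
      (vec v) := (contMDiff_fibreIncl v.proj).contMDiffAt.mdifferentiableAt (by simp)
  have hc := mfderiv_comp (vec v) hψ hι
  have hL : ψ ∘ (fibreIncl v.proj) = (L : E →L[ℝ] E) := by
    ext w; rfl
  rw [hL, ContinuousLinearMap.mfderiv_eq] at hc
  intro a b hab
  apply L.injective
  have ha := DFunLike.congr_fun hc a
  have hb := DFunLike.congr_fun hc b
  have hab' : mfderiv 𝓘(ℝ, E).tangent 𝓘(ℝ, E) ψ v (vertLift v a) =
    mfderiv 𝓘(ℝ, E).tangent 𝓘(ℝ, E) ψ v (vertLift v b) := by rw [hab]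
  exact ha.trans (hab'.trans hb.symm)

theorem range_vertLift [FiniteDimensional ℝ E] (v : TM E M) :
    LinearMap.range (vertLift v) = vertical v := by
  have : FiniteDimensional ℝ (TTM v) := inferInstanceAs (FiniteDimensional ℝ (E × E))
  have : FiniteDimensional ℝ (TangentSpace 𝓘(ℝ, E) v.proj) :=
    inferInstanceAs (FiniteDimensional ℝ E)
  apply Submodule.eq_of_le_of_finrank_eq
  · rintro _ ⟨w, rfl⟩
    have hι : MDifferentiableAt 𝓘(ℝ, E) 𝓘(ℝ, E).tangent (fibreIncl v.proj)
      (vec v) := (contMDiff_fibreIncl v.proj).contMDiffAt.mdifferentiableAt (by simp)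
    have hc := mfderiv_comp (vec v) (mdifferentiableAt_proj v) hι
    have h0 : (fun w : TM E M => w.proj) ∘ (fibreIncl v.proj) =
      fun _ => v.proj := rfl
    rw [h0, mfderiv_const] at hc
    exact (DFunLike.congr_fun hc w).symm
  · have h1 := LinearMap.finrank_range_add_finrank_ker (projStar v)
    have h2 := LinearMap.finrank_range_of_inj (vertLift_injective v)
    rw [LinearMap.range_eq_top.2 (projStar_surjective v), finrank_top] at h1
    have h3 : Module.finrank ℝ (TTM v) = Module.finrank ℝ (E × E) := rfl
    have h4 : Module.finrank ℝ (TangentSpace 𝓘(ℝ, E) v.proj) = Module.finrank ℝ E := rfl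
    rw [h3, Module.finrank_prod] at h1
    rw [h4] at h1 h2
    change _ = Module.finrank ℝ (LinearMap.ker (projStar v))
    omega

/-- The canonical isomorphism `K` from the vertical space at `v` onto `T_p M`, `p = π v`, inverse to
the vertical lift. -/
def K [FiniteDimensional ℝ E] (v : TM E M) : vertical v ≃ₗ[ℝ] TangentSpace 𝓘(ℝ, E) v.proj :=
  ((LinearEquiv.ofInjective (vertLift v) (vertLift_injective v)).trans
    (LinearEquiv.ofEq _ _ (range_vertLift v))).symm

variable (E M) in
/-- A (possibly nonlinear, Ehresmann) connection on `M`: a smooth vector subbundle of `TTM → TM`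
complementary to the vertical bundle. Smoothness of the subbundle is the local existence of smooth
frames. -/
structure Connection where
  /-- The horizontal space at `v`. -/
  hor (v : TM E M) : Submodule ℝ (TTM v)
  isCompl (v : TM E M) : IsCompl (hor v) (vertical v)
  smooth (v₀ : TM E M) : ∃ U : Set (TM E M), IsOpen U ∧ v₀ ∈ U ∧
    ∃ X : Fin (Module.finrank ℝ E) → (v : TM E M) → TTM v,
      (∀ i, ContMDiffOn 𝓘(ℝ, E).tangent 𝓘(ℝ, E).tangent.tangent ∞
        (fun v => (⟨v, X i v⟩ : TangentBundle 𝓘(ℝ, E).tangent (TM E M))) U) ∧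
      ∀ v ∈ U, LinearIndependent ℝ (fun i => X i v) ∧
        Submodule.span ℝ (Set.range fun i => X i v) = hor v

namespace Connection

/-- The horizontal projection `H_v` of `T_v TM`, with image the horizontal space and kernel the
vertical space. -/
def horProj (H : Connection E M) (v : TM E M) : TTM v →ₗ[ℝ] TTM v :=
  (H.hor v).projection (vertical v) (H.isCompl v)

theorem sub_horProj_mem (H : Connection E M) (v : TM E M) (z : TTM v) :
    z - H.horProj v z ∈ vertical v := by
  rw [← Submodule.ker_projection (H.isCompl v), LinearMap.mem_ker, map_sub, sub_eq_zero]
  exact (Submodule.projection_eq_self_iff (H.isCompl v) _ |>.2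
    (Submodule.projection_apply_mem (H.isCompl v) z)).symm

/-- The connector `κ`, `κ z = K (z - H_v z)` for `z ∈ T_v TM`. -/
def connector [FiniteDimensional ℝ E] (H : Connection E M) (v : TM E M) (z : TTM v) :
    TangentSpace 𝓘(ℝ, E) v.proj :=
  K v ⟨z - H.horProj v z, H.sub_horProj_mem v z⟩

/-- The covariant derivative `∇_U V = κ (V_* U)` at `x`, for a map `V : N → TM` (a vector field along
`π ∘ V : N → M`) and a tangent vector `u` of `N` at `x`. A vector field on `M` is the case `N = M`,
`π ∘ V = id`; a vector field along a curve is the case where `N` is the real line. -/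
def covDeriv [FiniteDimensional ℝ E] (H : Connection E M)
    {F : Type*} [NormedAddCommGroup F] [NormedSpace ℝ F]
    {N : Type*} [TopologicalSpace N] [ChartedSpace F N]
    (V : N → TM E M) (x : N) (u : TangentSpace 𝓘(ℝ, F) x) :
    TangentSpace 𝓘(ℝ, E) (V x).proj :=
  H.connector (V x) (mfderiv 𝓘(ℝ, F) 𝓘(ℝ, E).tangent V x u)

/-- If a vector field along a map `f` into `M` extends to a vector field `V` on `M`, its covariant
derivative in the direction `u` is that of `V` in the direction `f_* u`; for the velocity of a curve
`c` this means that `∇_ċ ċ` can be computed with any extension of `ċ` to a vector field on `M`. -/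
theorem covDeriv_comp [FiniteDimensional ℝ E] (H : Connection E M)
    {F : Type*} [NormedAddCommGroup F] [NormedSpace ℝ F]
    {N : Type*} [TopologicalSpace N] [ChartedSpace F N]
    (V : M → TM E M) (f : N → M) (x : N) (u : TangentSpace 𝓘(ℝ, F) x)
    (hV : MDifferentiableAt 𝓘(ℝ, E) 𝓘(ℝ, E).tangent V (f x))
    (hf : MDifferentiableAt 𝓘(ℝ, F) 𝓘(ℝ, E) f x) :
    H.covDeriv (V ∘ f) x u = H.covDeriv V (f x) (mfderiv 𝓘(ℝ, F) 𝓘(ℝ, E) f x u) := by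
  rw [covDeriv, covDeriv, mfderiv_comp x hV hf]
  rfl

theorem projStar_domRestrict_bijective (H : Connection E M) (v : TM E M) :
    Function.Bijective ((projStar v).domRestrict (H.hor v)) := by
  constructor
  · rw [← LinearMap.ker_eq_bot, LinearMap.ker_eq_bot']
    rintro ⟨z, hz⟩ h
    exact Subtype.ext ((Submodule.disjoint_def.1 (H.isCompl v).disjoint) z hz h)
  · intro u
    obtain ⟨z, rfl⟩ := projStar_surjective v u
    refine ⟨⟨H.horProj v z, Submodule.projection_apply_mem (H.isCompl v) z⟩, ?_⟩
    have h : projStar v (z - H.horProj v z) = 0 := H.sub_horProj_mem v z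
    rw [map_sub, sub_eq_zero] at h
    exact h.symm

/-- The geodesic quasispray of the connection: `S v` is the inverse image of `v ∈ T_p M` under the
isomorphism of the horizontal space at `v` onto `T_p M` given by restricting `π_*`. -/
def quasispray (H : Connection E M) (v : TM E M) : TTM v :=
  ((LinearEquiv.ofBijective _ (H.projStar_domRestrict_bijective v)).symm v.snd : H.hor v)

end Connection

/-- The velocity `ċ : ℝ → TM` of a curve `c` in `M`, its canonical lift to `TM`. -/
def velocity (c : ℝ → M) (t : ℝ) : TM E M :=
  ⟨c t, mfderiv 𝓘(ℝ, ℝ) 𝓘(ℝ, E) c t (1 : ℝ)⟩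

/-- `c` is a geodesic, on the open interval `s`, of the vector field `S` on `TM`: the canonical lift
of `c` is an integral curve of `S`. -/
def IsGeodesicOf (S : (v : TM E M) → TTM v) (c : ℝ → M) (s : Set ℝ) : Prop :=
  IsMIntegralCurveOn (I := 𝓘(ℝ, E).tangent) (velocity (E := E) c) S s

/-- The geodesics of a connection are those of its geodesic quasispray. -/
def Connection.IsGeodesic (H : Connection E M) (c : ℝ → M) (s : Set ℝ) : Prop :=
  IsGeodesicOf H.quasispray c s

end NonlinearConnection

end

namespace NonlinearConnection

section Velocity

variable {E : Type*} [NormedAddCommGroup E] [NormedSpace ℝ E]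
  {M : Type*} [TopologicalSpace M] [ChartedSpace E M] [IsManifold 𝓘(ℝ, E) ∞ M]

/-! The equivalence holds pointwise in `t`. Since `π ∘ ċ = c`, the chain rule gives `π_* c̈ = ċ`,
whatever the connection. On the horizontal space at `ċ`, `π_*` is an isomorphism, so `S(ċ)` is the
only horizontal vector with that projection. As `K` is injective, the connector kills exactly the
horizontal vectors. Hence `∇_ċ ċ = κ(c̈)` vanishes iff `c̈` is horizontal, iff `c̈ = S(ċ)`. The `C²`
assumption makes `ċ` differentiable, so that `c̈` is a true derivative and not the default value `0`
of `mfderiv`. -/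

/-- The canonical lift of a `C²` curve is of class `C¹`. -/
theorem contMDiffOn_velocity {c : ℝ → M} {s : Set ℝ} (hs : IsOpen s)
    (hc : ContMDiffOn 𝓘(ℝ, ℝ) 𝓘(ℝ, E) 2 c s) :
    ContMDiffOn 𝓘(ℝ, ℝ) 𝓘(ℝ, E).tangent 1 (velocity (E := E) c) s := by
  have hT := hc.contMDiffOn_tangentMapWithin (m := 1) (by norm_num) hs.uniqueMDiffOn
  -- The lift `ċ` is the tangent map of `c` composed with the unit vector field on the line.
  have hσ : ContMDiffOn 𝓘(ℝ, ℝ) 𝓘(ℝ, ℝ).tangent 1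
      (fun t : ℝ => (⟨t, (1 : ℝ)⟩ : TangentBundle 𝓘(ℝ, ℝ) ℝ)) s := fun t _ =>
    contMDiffWithinAt_vectorSpace_iff_contDiffWithinAt.2 contDiffWithinAt_const
  refine (hT.comp hσ fun t ht => ht).congr fun t ht => ?_
  simp only [velocity, Function.comp_apply, tangentMapWithin, mfderivWithin_of_isOpen hs ht]

theorem mdifferentiableAt_velocity {c : ℝ → M} {s : Set ℝ} (hs : IsOpen s)
    (hc : ContMDiffOn 𝓘(ℝ, ℝ) 𝓘(ℝ, E) 2 c s) {t : ℝ} (ht : t ∈ s) :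
    MDifferentiableAt 𝓘(ℝ, ℝ) 𝓘(ℝ, E).tangent (velocity (E := E) c) t :=
  ((contMDiffOn_velocity hs hc).contMDiffAt (hs.mem_nhds ht)).mdifferentiableAt (by simp)

/-- The velocity of a canonical lift is a second-order tangent vector: `π_* c̈ = ċ`. -/
theorem projStar_mfderiv_velocity {c : ℝ → M} {t : ℝ}
    (h : MDifferentiableAt 𝓘(ℝ, ℝ) 𝓘(ℝ, E).tangent (velocity (E := E) c) t) :
    projStar (velocity (E := E) c t)
      (mfderiv 𝓘(ℝ, ℝ) 𝓘(ℝ, E).tangent (velocity (E := E) c) t (1 : ℝ)) =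
        (velocity (E := E) c t).snd := by
  -- The composite `π ∘ ċ` is `c` by definition, so the chain rule evaluated at `1` is the claim.
  have hc := mfderiv_comp t (mdifferentiableAt_proj (velocity (E := E) c t)) h
  exact (DFunLike.congr_fun hc (1 : ℝ)).symm

end Velocity

namespace Connection

variable {E : Type*} [NormedAddCommGroup E] [NormedSpace ℝ E]
  {M : Type*} [TopologicalSpace M] [ChartedSpace E M] [IsManifold 𝓘(ℝ, E) ∞ M]

/-- The kernel of the connector is the horizontal space. -/
theorem connector_eq_zero_iff [FiniteDimensional ℝ E] (H : Connection E M) (v : TM E M)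
    (z : TTM v) : H.connector v z = 0 ↔ z ∈ H.hor v := by
  rw [connector, LinearEquiv.map_eq_zero_iff, Submodule.mk_eq_zero, sub_eq_zero, eq_comm]
  exact Submodule.projection_eq_self_iff (H.isCompl v) z

theorem quasispray_mem_hor (H : Connection E M) (v : TM E M) : H.quasispray v ∈ H.hor v :=
  Subtype.prop _

theorem projStar_quasispray (H : Connection E M) (v : TM E M) :
    projStar v (H.quasispray v) = v.snd :=
  (LinearEquiv.ofBijective _ (H.projStar_domRestrict_bijective v)).apply_symm_apply v.snd

/-- Among the vectors `z` with `π_* z = v`, the quasispray is the one killed by the connector. -/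
theorem connector_eq_zero_iff_eq_quasispray [FiniteDimensional ℝ E] (H : Connection E M)
    {v : TM E M} {z : TTM v} (hz : projStar v z = v.snd) :
    H.connector v z = 0 ↔ z = H.quasispray v := by
  rw [connector_eq_zero_iff]
  refine ⟨fun h => ?_, fun h => h ▸ H.quasispray_mem_hor v⟩
  -- Two horizontal vectors with the same image under `π_*` coincide.
  have := (H.projStar_domRestrict_bijective v).injective
    (a₁ := ⟨z, h⟩) (a₂ := ⟨H.quasispray v, H.quasispray_mem_hor v⟩)
    (hz.trans (H.projStar_quasispray v).symm)
  exact congrArg Subtype.val this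

end Connection

end NonlinearConnection

theorem mainTheorem4 {E : Type*} [NormedAddCommGroup E] [NormedSpace ℝ E] [FiniteDimensional ℝ E]
    {M : Type*} [TopologicalSpace M] [ChartedSpace E M] [IsManifold 𝓘(ℝ, E) ∞ M]
    [T2Space M] [ParacompactSpace M] [ConnectedSpace M]
    (H : NonlinearConnection.Connection E M)
    (s : Set ℝ) (hs : IsOpen s) (hs' : s.OrdConnected)
    (c : ℝ → M) (hc : ContMDiffOn 𝓘(ℝ, ℝ) 𝓘(ℝ, E) 2 c s) :
    H.IsGeodesic c s ↔
      ∀ t ∈ s, H.covDeriv (NonlinearConnection.velocity (E := E) c) t (1 : ℝ) = 0 := by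
  have key : ∀ t ∈ s, (H.covDeriv (NonlinearConnection.velocity (E := E) c) t (1 : ℝ) = 0 ↔
      mfderiv 𝓘(ℝ, ℝ) 𝓘(ℝ, E).tangent (NonlinearConnection.velocity (E := E) c) t (1 : ℝ) =
        H.quasispray (NonlinearConnection.velocity (E := E) c t)) := fun t ht =>
    H.connector_eq_zero_iff_eq_quasispray
      (NonlinearConnection.projStar_mfderiv_velocity
        (NonlinearConnection.mdifferentiableAt_velocity hs hc ht))
  -- Being an integral curve unfolds to a condition at each `t ∈ s`: within `s`, `ċ` has derivative
  -- `r ↦ r • S(ċ t)`.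
  refine forall₂_congr fun t ht => ?_
  rw [key t ht]
  constructor
  · intro h
    rw [(h.hasMFDerivAt (hs.mem_nhds ht)).mfderiv]
    exact one_smul ℝ _
  · intro h
    -- The converse also needs the derivative to exist; a linear map on `ℝ` is then determined by
    -- its value at `1`.
    have hd := (NonlinearConnection.mdifferentiableAt_velocity hs hc ht).hasMFDerivAt
    refine (hd.congr_mfderiv ?_).hasMFDerivWithinAt
    refine ContinuousLinearMap.ext_ring ?_
    exact h.trans (one_smul ℝ _).symm
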